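/- Let $K$ be a commutative ring with unit and let $S$ be a unital inverse semigroup, with $s^*$ the inverse of $s$ and with its natural partial order ($s\le t$ iff $s=te$ for some idempotent $e\in S$). Let $\mathrm{Pr}(S)$ be the semigroup generated by symbols $[s]$ ($s\in S$) subject to the relations $$[s^*][s][t]=[s^*][st],\qquad [s][t][t^*]=[st][t^*],\qquad [s][s^*][s]=[s]\qquad (s,t\in S),$$ and let $K_{par}(S)=K\,\mathrm{Pr}(S)$ be its semigroup algebra over $K$, which is unital with unit $[1]$. Let $\iota_S:S\to K_{par}(S)$, $s\mapsto[s]$, let $J$ be the two-sided ideal of $K_{par}(S)$ generated by all elements $a\,\iota_S(s)-a\,\iota_S(t)$ with $a\in K_{par}(S)$, $s,t\in S$ and $s\le t$, and let $\tilde\iota_S:S\to K_{par}(S)/J$ be the composition of $\iota_S$ with the quotient map. Put $\tilde\varepsilon_s=\tilde\iota_S(s)\tilde\iota_S(s^*)$, let $A$ be the subalgebra of $K_{par}(S)/J$ generated by all $\tilde\varepsilon_s$, $s\in S$, let $X_s=\tilde\varepsilon_sA$, and let $\alpha$ be the partial action of $S$ on $A$ given by the isomorphisms $\alpha_s:X_{s^*}\to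 X_s$, $\alpha_s(a)=\tilde\iota_S(s)\,a\,\tilde\iota_S(s^*)$. Let $L$ be the algebra of all finite formal sums $\sum_{s\in S}a_s\delta_s$ with $a_s\in X_s$ and multiplication determined by $$(a_s\delta_s)(b_t\delta_t)=\alpha_s(\alpha_{s^*}(a_s)\,b_t)\,\delta_{st},$$ let $I$ be the two-sided ideal of $L$ generated by all $a\delta_r-a\delta_t$ with $r\le t$ and $a\in X_r$ (so that $X_r\subseteq X_t$), and let $A\times_\alpha S=L/I$ be the algebraic crossed product. Then $$\phi:A\times_\alpha S\to K_{par}(S)/J,\qquad \phi\Big(\overline{\textstyle\sum_{s}a_s\delta_s}\Big)=\sum_{s}a_s\,\tilde\iota_S(s),$$ is a well-defined map and an isomorphism of $K$-algebras. -/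

import Mathlib

/-! ### Unital inverse semigroups -/

/-- A unital inverse semigroup: every `a` has exactly one generalized inverse `a⁻¹`
(written `a^*` in the literature), i.e. `a a⁻¹ a = a` and `a⁻¹ a a⁻¹ = a⁻¹`. -/
class InverseMonoid (S : Type*) extends Monoid S, Inv S where
  mul_inv_mul' : ∀ a : S, a * a⁻¹ * a = a
  inv_mul_inv' : ∀ a : S, a⁻¹ * a * a⁻¹ = a⁻¹
  inv_unique' : ∀ a b : S, a * b * a = a → b * a * b = b → b = a⁻¹

namespace InverseMonoid

variable {S : Type*} [InverseMonoid S]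

/-- The natural partial order of an inverse semigroup: `r ≤ t` iff `r = t e` for some
idempotent `e`. -/
def NatLE (r t : S) : Prop := ∃ e : S, e * e = e ∧ r = t * e

theorem inv_inv' (a : S) : a⁻¹⁻¹ = a :=
  (inv_unique' a⁻¹ a (inv_mul_inv' a) (mul_inv_mul' a)).symm

theorem inv_of_idem {e : S} (he : e * e = e) : e⁻¹ = e :=
  (inv_unique' e e (by rw [he, he]) (by rw [he, he])).symm

theorem idem_mul_idem {e f : S} (he : e * e = e) (hf : f * f = f) :
    e * f * (e * f) = e * f := by
  have h1 := mul_inv_mul' (e * f)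
  have h2 := inv_mul_inv' (e * f)
  set x := (e * f)⁻¹ with hx
  have hx' : f * x * e = x := by
    apply inv_unique' (e * f) (f * x * e)
    · calc e * f * (f * x * e) * (e * f) = e * (f * f) * x * (e * e) * f := by
            simp only [mul_assoc]
        _ = e * f * x * (e * f) := by rw [he, hf]; simp only [mul_assoc]
        _ = e * f := h1
    · calc f * x * e * (e * f) * (f * x * e) = f * (x * ((e * e) * (f * f)) * x) * e := by
            simp only [mul_assoc]
        _ = f * x * e := by rw [he, hf, h2]
  have hxx : x * x = x := by
    calc x * x = f * x * e * (f * x * e) := by rw [hx']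
      _ = f * (x * (e * f) * x) * e := by simp only [mul_assoc]
      _ = x := by rw [h2, hx']
  have : e * f = x := by
    rw [← inv_inv' (e * f), ← hx, inv_of_idem hxx]
  rw [this, hxx]

theorem idem_comm {e f : S} (he : e * e = e) (hf : f * f = f) : e * f = f * e := by
  have h1 := idem_mul_idem he hf
  have h2 := idem_mul_idem hf he
  have : f * e = (e * f)⁻¹ := by
    apply inv_unique'
    · calc e * f * (f * e) * (e * f) = e * (f * f) * (e * e) * f := by simp only [mul_assoc]
        _ = e * f := by rw [he, hf, mul_assoc, h1]
    · calc f * e * (e * f) * (f * e) = f * (e * e) * (f * f) * e := by simp only [mul_assoc]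
        _ = f * e := by rw [he, hf, mul_assoc, h2]
  rw [this, inv_of_idem h1]

theorem mul_inv_idem (a : S) : a * a⁻¹ * (a * a⁻¹) = a * a⁻¹ := by
  rw [← mul_assoc, mul_inv_mul']

theorem inv_mul_idem (a : S) : a⁻¹ * a * (a⁻¹ * a) = a⁻¹ * a := by
  rw [← mul_assoc, inv_mul_inv']

theorem mul_inv_rev' (a b : S) : (a * b)⁻¹ = b⁻¹ * a⁻¹ := by
  have hc := idem_comm (inv_mul_idem a) (mul_inv_idem b)
  symm
  apply inv_unique'
  · calc a * b * (b⁻¹ * a⁻¹) * (a * b) = a * ((b * b⁻¹) * (a⁻¹ * a)) * b := by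
          simp only [mul_assoc]
      _ = (a * a⁻¹ * a) * (b * b⁻¹ * b) := by rw [← hc]; simp only [mul_assoc]
      _ = a * b := by rw [mul_inv_mul', mul_inv_mul']
  · calc b⁻¹ * a⁻¹ * (a * b) * (b⁻¹ * a⁻¹) = b⁻¹ * ((a⁻¹ * a) * (b * b⁻¹)) * a⁻¹ := by
          simp only [mul_assoc]
      _ = (b⁻¹ * b * b⁻¹) * (a⁻¹ * a * a⁻¹) := by rw [hc]; simp only [mul_assoc]
      _ = b⁻¹ * a⁻¹ := by rw [inv_mul_inv', inv_mul_inv']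

/-- If `r ≤ t` then `r = (r r⁻¹) t`. -/
theorem NatLE.eq_left {r t : S} (h : NatLE r t) : r = r * r⁻¹ * t := by
  obtain ⟨e, he, rfl⟩ := h
  have hc := idem_comm he (inv_mul_idem t)
  rw [mul_inv_rev', inv_of_idem he]
  calc t * e = t * t⁻¹ * t * (e * e) := by rw [he, mul_inv_mul']
    _ = t * ((t⁻¹ * t) * e) * e := by simp only [mul_assoc]
    _ = t * (e * e) * (t⁻¹ * t) := by
        rw [← hc, mul_assoc t, mul_assoc e, ← hc, ← mul_assoc e e, mul_assoc t]
    _ = t * e * (e * t⁻¹) * t := by simp only [mul_assoc]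

end InverseMonoid

open InverseMonoid

/-! ### Partial actions and their algebraic crossed products -/

/-- A partial action of a unital inverse semigroup `S` on an associative `K`-algebra `A`:
two-sided ideals `X s` and algebra isomorphisms `α s : X s⁻¹ → X s` such that
`α s⁻¹` is the inverse of `α s`, `α s (X s⁻¹ ∩ X t) = X s ∩ X (s t)`, and `α s ∘ α t` agrees with
`α (s t)` on `(α t)⁻¹ (X t ∩ X s⁻¹)`. -/
structure PartialAction (K S A : Type*) [CommRing K] [InverseMonoid S] [NonUnitalRing A]
    [Module K A] [IsScalarTower K A A] [SMulCommClass K A A] where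
  X : S → Submodule K A
  mul_mem_left : ∀ (s : S) (a : A) {x : A}, x ∈ X s → a * x ∈ X s
  mul_mem_right : ∀ (s : S) (a : A) {x : A}, x ∈ X s → x * a ∈ X s
  α : ∀ s : S, X s⁻¹ ≃ₗ[K] X s
  map_mul : ∀ (s : S) (x y : X s⁻¹),
    (α s ⟨(x : A) * (y : A), mul_mem_left _ _ y.2⟩ : A) = (α s x : A) * (α s y : A)
  symm_eq : ∀ (s : S) (x : X s⁻¹), ((α s⁻¹).symm x : A) = (α s x : A)
  /-- As `α s` is a bijection of `X s⁻¹` onto `X s`, this is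
  `α s (X s⁻¹ ∩ X t) = X s ∩ X (s t)`. -/
  mem_iff : ∀ (s t : S) (x : X s⁻¹), (x : A) ∈ X t ↔ (α s x : A) ∈ X (s * t)
  comp_eq : ∀ (s t : S) (a : A) (h1 : a ∈ X t⁻¹) (h2 : (α t ⟨a, h1⟩ : A) ∈ X s⁻¹)
    (h3 : a ∈ X (s * t)⁻¹), (α s ⟨(α t ⟨a, h1⟩ : A), h2⟩ : A) = (α (s * t) ⟨a, h3⟩ : A)

namespace PartialAction

variable {K S A : Type*} [CommRing K] [InverseMonoid S] [NonUnitalRing A]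
  [Module K A] [IsScalarTower K A A] [SMulCommClass K A A] (P : PartialAction K S A)

theorem X_le_mul_inv (s : S) : P.X s ≤ P.X (s * s⁻¹) := by
  intro a ha
  have h := (P.mem_iff s s⁻¹ ((P.α s).symm ⟨a, ha⟩)).1 ((P.α s).symm ⟨a, ha⟩).2
  simpa using h

theorem α_idem {e : S} (he : e * e = e) (x : P.X e⁻¹) : (P.α e x : A) = x := by
  have hi : e⁻¹ = e := inv_of_idem he
  have h2 : (P.α e x : A) ∈ P.X e⁻¹ := (congrArg P.X hi).ge (P.α e x).2
  have h3 : (x : A) ∈ P.X (e * e)⁻¹ := by rw [he]; exact x.2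
  have h := P.comp_eq e e x x.2 h2 h3
  have h4 : (P.α (e * e) ⟨(x : A), h3⟩ : A) = P.α e x := by
    have key : ∀ (f : S) (hf : f = e) (h : (x : A) ∈ P.X f⁻¹),
        (P.α f ⟨(x : A), h⟩ : A) = P.α e x := by
      intro f hf h; subst hf; rfl
    exact key _ he h3
  rw [h4] at h
  have h5 := (P.α e).injective (Subtype.ext h)
  exact congrArg Subtype.val h5

/-- `X r ⊆ X t` whenever `r ≤ t`. -/
theorem X_mono {r t : S} (h : NatLE r t) : P.X r ≤ P.X t := by
  intro a ha
  have he : r * r⁻¹ * (r * r⁻¹) = r * r⁻¹ := mul_inv_idem r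
  have h1 : a ∈ P.X (r * r⁻¹)⁻¹ := by
    rw [inv_of_idem he]; exact P.X_le_mul_inv r ha
  refine (P.mem_iff (r * r⁻¹) t ⟨a, h1⟩).2 ?_
  rw [P.α_idem he, ← h.eq_left]
  exact ha

/-- `α_{s⁻¹}(a) b ∈ X s⁻¹` for `a ∈ X s`, `b ∈ X t`, where `α_{s⁻¹}` is written as the inverse
of `α_s`. -/
def mulInner (s t : S) : P.X s →ₗ[K] P.X t →ₗ[K] P.X s⁻¹ :=
  LinearMap.mk₂ K
    (fun a b => ⟨((P.α s).symm a : A) * (b : A), P.mul_mem_right _ _ ((P.α s).symm a).2⟩)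
    (fun a a' b => Subtype.ext (by simp [add_mul]))
    (fun c a b => Subtype.ext (by simp [smul_mul_assoc]))
    (fun a b b' => Subtype.ext (by simp [mul_add]))
    (fun c a b => Subtype.ext (by simp [mul_smul_comm]))

theorem α_mul_mem (s t : S) (a : P.X s) (b : P.X t) :
    (P.α s (P.mulInner s t a b) : A) ∈ P.X (s * t) :=
  (P.mem_iff s t _).1 (P.mul_mem_left _ _ b.2)

/-- The bilinear map `(a, b) ↦ α_s (α_{s⁻¹}(a) b)`, from `X s × X t` to `X (s t)`. -/
def mulAux (s t : S) : P.X s →ₗ[K] P.X t →ₗ[K] P.X (s * t) :=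
  LinearMap.mk₂ K
    (fun a b => ⟨P.α s (P.mulInner s t a b), P.α_mul_mem s t a b⟩)
    (fun a a' b => Subtype.ext (by simp))
    (fun c a b => Subtype.ext (by simp))
    (fun a b b' => Subtype.ext (by simp))
    (fun c a b => Subtype.ext (by simp))

/-- The algebra `L` of formal finite sums `∑ a_s δ_s` with `a_s ∈ X s`. -/
def L : Type _ := DirectSum S (fun s => P.X s)

noncomputable instance : AddCommGroup P.L :=
  inferInstanceAs (AddCommGroup (DirectSum S (fun s => P.X s)))

noncomputable instance : Module K P.L :=
  inferInstanceAs (Module K (DirectSum S (fun s => P.X s)))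

open Classical in
/-- `a ↦ a δ_s`, for `a ∈ X s`. -/
noncomputable def δ (s : S) : P.X s →ₗ[K] P.L :=
  DirectSum.lof K S (fun s => P.X s) s

open Classical in
/-- The linear map on `L` determined by its values on the elements `a δ_s`. -/
noncomputable def liftL {M : Type*} [AddCommGroup M] [Module K M]
    (f : ∀ s : S, P.X s →ₗ[K] M) : P.L →ₗ[K] M :=
  DirectSum.toModule K S M f

theorem liftL_δ {M : Type*} [AddCommGroup M] [Module K M]
    (f : ∀ s : S, P.X s →ₗ[K] M) (s : S) (a : P.X s) : P.liftL f (P.δ s a) = f s a := by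
  classical
  exact DirectSum.toModule_lof (M := fun s => P.X s) (φ := f) K s a

/-- The multiplication of `L` as a bilinear map:
`(a δ_s)(b δ_t) = α_s (α_{s⁻¹}(a) b) δ_{st}`. -/
noncomputable def mulL : P.L →ₗ[K] P.L →ₗ[K] P.L :=
  P.liftL fun s => LinearMap.flip (P.liftL fun t =>
    LinearMap.flip ((P.mulAux s t).compr₂ (P.δ (s * t))))

noncomputable instance : Mul P.L := ⟨fun x y => P.mulL x y⟩

noncomputable instance : NonUnitalNonAssocRing P.L :=
  { (inferInstance : AddCommGroup P.L), (inferInstance : Mul P.L) with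
    left_distrib := fun x y z => map_add (P.mulL x) y z
    right_distrib := fun x y z => LinearMap.map_add₂ P.mulL x y z
    zero_mul := fun x => LinearMap.map_zero₂ P.mulL x
    mul_zero := fun x => map_zero (P.mulL x) }

instance : IsScalarTower K P.L P.L := ⟨fun c x y => LinearMap.map_smul₂ P.mulL c x y⟩

instance : SMulCommClass K P.L P.L := ⟨fun c x y => (map_smul (P.mulL x) c y).symm⟩

theorem δ_mul_δ (s t : S) (a : P.X s) (b : P.X t) :
    P.δ s a * P.δ t b = P.δ (s * t) (P.mulAux s t a b) := by
  change P.mulL (P.δ s a) (P.δ t b) = _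
  simp only [mulL, liftL_δ, LinearMap.flip_apply, LinearMap.compr₂_apply]

/-- The generators `a δ_r - a δ_t` (`r ≤ t`, `a ∈ X r`) of the ideal `I`. -/
def relators : Set P.L :=
  {x | ∃ (r t : S) (h : NatLE r t) (a : P.X r),
    x = P.δ r a - P.δ t ⟨(a : A), P.X_mono h a.2⟩}

/-- The two-sided ideal `I` of the algebra `L` generated by the elements `a δ_r - a δ_t`
(`r ≤ t`, `a ∈ X r`): the smallest subspace that contains them and is closed under left and right
multiplication by `L`. -/
noncomputable def I : Submodule K P.L :=
  sInf {N | P.relators ⊆ N ∧ ∀ x y : P.L, y ∈ N → x * y ∈ N ∧ y * x ∈ N}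

theorem I_mul_mem (x : P.L) {y : P.L} (hy : y ∈ P.I) : x * y ∈ P.I ∧ y * x ∈ P.I := by
  simp only [I, Submodule.mem_sInf] at hy ⊢
  exact ⟨fun N hN => (hN.2 x y (hy N hN)).1, fun N hN => (hN.2 x y (hy N hN)).2⟩

/-- The algebraic crossed product `A ×_α S = L / I`. -/
def CrossedProduct : Type _ := P.L ⧸ P.I

namespace CrossedProduct

noncomputable instance : AddCommGroup P.CrossedProduct :=
  inferInstanceAs (AddCommGroup (P.L ⧸ P.I))

noncomputable instance : Module K P.CrossedProduct :=
  inferInstanceAs (Module K (P.L ⧸ P.I))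

/-- The quotient map `L → A ×_α S`. -/
noncomputable def mk : P.L →ₗ[K] P.CrossedProduct := P.I.mkQ

theorem mk_surjective : Function.Surjective (mk P) := Submodule.mkQ_surjective _

theorem mk_eq_mk {x y : P.L} : mk P x = mk P y ↔ x - y ∈ P.I := Submodule.Quotient.eq _

/-- The product of two classes is the class of the product. -/
noncomputable instance : Mul P.CrossedProduct :=
  ⟨Quotient.map₂ (fun x y : P.L => x * y) (by
    intro x x' hx y y' hy
    have hx' : x - x' ∈ P.I := (Submodule.quotientRel_def _).1 hx
    have hy' : y - y' ∈ P.I := (Submodule.quotientRel_def _).1 hy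
    refine (Submodule.quotientRel_def _).2 ?_
    have : x * y - x' * y' = (x - x') * y + x' * (y - y') := by
      rw [sub_mul, mul_sub]; abel
    rw [this]
    exact add_mem (P.I_mul_mem y hx').2 (P.I_mul_mem x' hy').1)⟩

theorem mk_mul (x y : P.L) : mk P (x * y) = mk P x * mk P y := rfl

noncomputable instance : NonUnitalNonAssocRing P.CrossedProduct :=
  { (inferInstance : AddCommGroup P.CrossedProduct), (inferInstance : Mul P.CrossedProduct) with
    left_distrib := fun x y z => by
      obtain ⟨x, rfl⟩ := mk_surjective P x
      obtain ⟨y, rfl⟩ := mk_surjective P y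
      obtain ⟨z, rfl⟩ := mk_surjective P z
      rw [← mk_mul, ← mk_mul, ← map_add, ← map_add, ← mk_mul, mul_add]
    right_distrib := fun x y z => by
      obtain ⟨x, rfl⟩ := mk_surjective P x
      obtain ⟨y, rfl⟩ := mk_surjective P y
      obtain ⟨z, rfl⟩ := mk_surjective P z
      rw [← mk_mul, ← mk_mul, ← map_add, ← map_add, ← mk_mul, add_mul]
    zero_mul := fun x => by
      obtain ⟨x, rfl⟩ := mk_surjective P x
      rw [← map_zero (mk P), ← mk_mul, zero_mul]
    mul_zero := fun x => by
      obtain ⟨x, rfl⟩ := mk_surjective P x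
      rw [← map_zero (mk P), ← mk_mul, mul_zero] }

instance : IsScalarTower K P.CrossedProduct P.CrossedProduct := ⟨fun c x y => by
  obtain ⟨x, rfl⟩ := mk_surjective P x
  obtain ⟨y, rfl⟩ := mk_surjective P y
  change c • mk P x * mk P y = c • (mk P x * mk P y)
  rw [← map_smul, ← mk_mul, ← mk_mul, ← map_smul, smul_mul_assoc]⟩

instance : SMulCommClass K P.CrossedProduct P.CrossedProduct := ⟨fun c x y => by
  obtain ⟨x, rfl⟩ := mk_surjective P x
  obtain ⟨y, rfl⟩ := mk_surjective P y
  change c • (mk P x * mk P y) = mk P x * c • mk P y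
  rw [← map_smul, ← mk_mul, ← mk_mul, ← map_smul, mul_smul_comm]⟩

end CrossedProduct

end PartialAction

/-! ### Partial representations and the partial actions they induce -/

/-- A partial representation of `S` (in a semigroup `B`, or in the multiplicative semigroup of
an algebra `B`). -/
structure IsPartialRep {S B : Type*} [InverseMonoid S] [Semigroup B] (π : S → B) : Prop where
  inv_mul_mul : ∀ s t : S, π s⁻¹ * π s * π t = π s⁻¹ * π (s * t)
  mul_mul_inv : ∀ s t : S, π s * π t * π t⁻¹ = π (s * t) * π t⁻¹
  mul_inv_mul : ∀ s : S, π s * π s⁻¹ * π s = π s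

namespace IsPartialRep

section Semigroup

variable {S B : Type*} [InverseMonoid S] [Semigroup B] {π : S → B}

theorem map {B' : Type*} [Semigroup B'] (hπ : IsPartialRep π) (f : B →ₙ* B') :
    IsPartialRep (fun s => f (π s)) where
  inv_mul_mul s t := by simp only [← map_mul, hπ.inv_mul_mul]
  mul_mul_inv s t := by simp only [← map_mul, hπ.mul_mul_inv]
  mul_inv_mul s := by simp only [← map_mul, hπ.mul_inv_mul]

theorem one_mul' (hπ : IsPartialRep π) (s : S) : π 1 * π s = π s := by
  have h := hπ.mul_mul_inv 1 s
  rw [one_mul] at h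
  rw [← hπ.mul_inv_mul s, ← mul_assoc, ← mul_assoc, h]

theorem mul_one' (hπ : IsPartialRep π) (s : S) : π s * π 1 = π s := by
  have h := hπ.inv_mul_mul s 1
  rw [mul_one] at h
  conv_lhs => rw [← hπ.mul_inv_mul s]
  rw [mul_assoc (π s), mul_assoc (π s), h, ← mul_assoc, hπ.mul_inv_mul]

/-- The idempotent `ε_s = π(s) π(s⁻¹)`. -/
def ε (π : S → B) (s : S) : B := π s * π s⁻¹

theorem mul_mul_inv' (hπ : IsPartialRep π) (s t : S) :
    π s * π s⁻¹ * π t = π s * π (s⁻¹ * t) := by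
  simpa only [inv_inv'] using hπ.inv_mul_mul s⁻¹ t

theorem mul_inv_mul_mul (hπ : IsPartialRep π) (s t : S) :
    π s * π t⁻¹ * π t = π (s * t⁻¹) * π t := by
  simpa only [inv_inv'] using hπ.mul_mul_inv s t⁻¹

theorem ε_mul_self (hπ : IsPartialRep π) (s : S) : ε π s * ε π s = ε π s := by
  rw [ε, ← mul_assoc, hπ.mul_inv_mul]

theorem ε_mul_π (hπ : IsPartialRep π) (s : S) : ε π s * π s = π s := hπ.mul_inv_mul s

theorem π_mul_ε_inv (hπ : IsPartialRep π) (s : S) : π s * ε π s⁻¹ = π s := by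
  rw [ε, inv_inv', ← mul_assoc, hπ.mul_inv_mul]

theorem ε_mul_ε_eq (hπ : IsPartialRep π) (s t : S) :
    ε π s * ε π t = π (s * (s⁻¹ * t)) * π (t⁻¹ * s) * π (s⁻¹ * t * t⁻¹) := by
  have e : (s⁻¹ * t)⁻¹ = t⁻¹ * s := by rw [mul_inv_rev', inv_inv']
  have h1 := hπ.mul_inv_mul (s⁻¹ * t)
  have h2 := hπ.mul_mul_inv s (s⁻¹ * t)
  have h3 := hπ.inv_mul_mul (s⁻¹ * t) t⁻¹
  rw [e] at h1 h2 h3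
  calc ε π s * ε π t = π s * π s⁻¹ * π t * π t⁻¹ := by simp only [ε, mul_assoc]
    _ = π s * π (s⁻¹ * t) * π t⁻¹ := by rw [hπ.mul_mul_inv']
    _ = π s * π (s⁻¹ * t) * π (t⁻¹ * s) * π (s⁻¹ * t) * π t⁻¹ := by
        conv_lhs => rw [← h1]
        simp only [mul_assoc]
    _ = π (s * (s⁻¹ * t)) * (π (t⁻¹ * s) * π (s⁻¹ * t) * π t⁻¹) := by
        rw [h2]; simp only [mul_assoc]
    _ = _ := by rw [h3]; simp only [mul_assoc]

theorem ε_comm (hπ : IsPartialRep π) (s t : S) : ε π s * ε π t = ε π t * ε π s := by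
  have e : (t⁻¹ * s)⁻¹ = s⁻¹ * t := by rw [mul_inv_rev', inv_inv']
  have hc := idem_comm (mul_inv_idem s) (mul_inv_idem t)
  have h1 := hπ.mul_inv_mul (t⁻¹ * s)
  have h2 := hπ.mul_mul_inv (t * (t⁻¹ * s)) (s⁻¹ * t)
  have h3 := hπ.inv_mul_mul (s⁻¹ * t) (t⁻¹ * s * s⁻¹)
  have e' : (s⁻¹ * t)⁻¹ = t⁻¹ * s := by rw [mul_inv_rev', inv_inv']
  have h4 := hπ.mul_inv_mul (s⁻¹ * t)
  rw [e'] at h2 h3 h4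
  have g1 : t * (t⁻¹ * s) * (s⁻¹ * t) = s * (s⁻¹ * t) := by
    calc t * (t⁻¹ * s) * (s⁻¹ * t) = (t * t⁻¹) * (s * s⁻¹) * t := by simp only [mul_assoc]
      _ = s * s⁻¹ * (t * t⁻¹ * t) := by rw [← hc]; simp only [mul_assoc]
      _ = s * (s⁻¹ * t) := by rw [mul_inv_mul', mul_assoc]
  have g2 : s⁻¹ * t * (t⁻¹ * s * s⁻¹) = s⁻¹ * t * t⁻¹ := by
    calc s⁻¹ * t * (t⁻¹ * s * s⁻¹) = s⁻¹ * ((t * t⁻¹) * (s * s⁻¹)) := by simp only [mul_assoc]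
      _ = (s⁻¹ * s * s⁻¹) * (t * t⁻¹) := by rw [← hc]; simp only [mul_assoc]
      _ = s⁻¹ * t * t⁻¹ := by rw [inv_mul_inv', mul_assoc]
  rw [g1] at h2
  rw [g2] at h3
  rw [hπ.ε_mul_ε_eq s t, hπ.ε_mul_ε_eq t s]
  symm
  calc π (t * (t⁻¹ * s)) * π (s⁻¹ * t) * π (t⁻¹ * s * s⁻¹)
      = π (t * (t⁻¹ * s)) * (π (s⁻¹ * t) * π (t⁻¹ * s) * π (s⁻¹ * t)) * π (t⁻¹ * s * s⁻¹) := by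
        rw [h4]
    _ = (π (t * (t⁻¹ * s)) * π (s⁻¹ * t) * π (t⁻¹ * s)) * π (s⁻¹ * t) * π (t⁻¹ * s * s⁻¹) := by
        simp only [mul_assoc]
    _ = π (s * (s⁻¹ * t)) * (π (t⁻¹ * s) * π (s⁻¹ * t) * π (t⁻¹ * s * s⁻¹)) := by
        rw [h2]; simp only [mul_assoc]
    _ = _ := by rw [h3]; simp only [mul_assoc]

theorem π_mul_ε (hπ : IsPartialRep π) (s t : S) : π s * ε π t = ε π (s * t) * π s := by
  symm
  calc ε π (s * t) * π s = π (s * t) * (π (t⁻¹ * s⁻¹) * π s) := by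
        rw [ε, mul_inv_rev', mul_assoc]
    _ = π (s * t) * π t⁻¹ * π s⁻¹ * π s := by
        rw [← hπ.mul_inv_mul_mul]; simp only [mul_assoc]
    _ = π s * (ε π t * ε π s⁻¹) := by
        rw [← hπ.mul_mul_inv, ε, ε, inv_inv']; simp only [mul_assoc]
    _ = π s * ε π t := by
        rw [hπ.ε_comm, ← mul_assoc, hπ.π_mul_ε_inv]

end Semigroup

variable {K S B : Type*} [CommRing K] [InverseMonoid S] [Ring B] [Algebra K B]

variable (K) in
/-- The subalgebra `A` of `B` generated by the idempotents `ε_s`, i.e. the span of all products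
`ε_{t_1} ⋯ ε_{t_n}` with `n ≥ 1`. -/
def subalg (π : S → B) : NonUnitalSubalgebra K B :=
  NonUnitalAlgebra.adjoin K (Set.range (ε π))

variable (K) in
theorem ε_mem (π : S → B) (s : S) : ε π s ∈ subalg K π :=
  NonUnitalAlgebra.subset_adjoin K ⟨s, rfl⟩

variable {π : S → B}

theorem ε_comm_mem (hπ : IsPartialRep π) (s : S) {a : B} (ha : a ∈ subalg K π) :
    ε π s * a = a * ε π s := by
  induction ha using NonUnitalAlgebra.adjoin_induction with
  | mem x hx => obtain ⟨t, rfl⟩ := hx; exact hπ.ε_comm s t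
  | add x y _ _ hx hy => rw [mul_add, add_mul, hx, hy]
  | zero => simp
  | mul x y _ _ hx hy => rw [← mul_assoc, hx, mul_assoc, hy, mul_assoc]
  | smul c x _ hx => rw [mul_smul_comm, smul_mul_assoc, hx]

theorem conj_mul (hπ : IsPartialRep π) (s : S) {a : B} (b : B) (ha : a ∈ subalg K π) :
    π s * (a * b) * π s⁻¹ = (π s * a * π s⁻¹) * (π s * b * π s⁻¹) := by
  calc π s * (a * b) * π s⁻¹ = π s * ε π s⁻¹ * a * b * π s⁻¹ := by
        rw [hπ.π_mul_ε_inv]; simp only [mul_assoc]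
    _ = π s * (a * ε π s⁻¹) * b * π s⁻¹ := by
        rw [mul_assoc (π s), hπ.ε_comm_mem s⁻¹ ha]
    _ = _ := by rw [ε, inv_inv']; simp only [mul_assoc]

theorem conj_mem (hπ : IsPartialRep π) (s : S) {a : B} (ha : a ∈ subalg K π) :
    π s * a * π s⁻¹ ∈ subalg K π := by
  induction ha using NonUnitalAlgebra.adjoin_induction with
  | mem x hx =>
    obtain ⟨t, rfl⟩ := hx
    rw [hπ.π_mul_ε, mul_assoc]
    exact mul_mem (ε_mem K π _) (ε_mem K π s)
  | add x y _ _ hx hy => rw [mul_add, add_mul]; exact add_mem hx hy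
  | zero => simp
  | mul x y hx' _ hx hy => rw [hπ.conj_mul s y hx']; exact mul_mem hx hy
  | smul c x _ hx => rw [mul_smul_comm, smul_mul_assoc]; exact SMulMemClass.smul_mem c hx

variable (K) in
/-- The ideal `X_s = ε_s A` of `A`. -/
def ideal (π : S → B) (s : S) : Submodule K (subalg K π) :=
  LinearMap.range (LinearMap.mulLeft K (⟨ε π s, ε_mem K π s⟩ : subalg K π))

theorem mem_ideal (hπ : IsPartialRep π) (s : S) (a : subalg K π) :
    a ∈ ideal K π s ↔ ε π s * (a : B) = a := by
  constructor
  · rintro ⟨b, rfl⟩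
    change ε π s * (ε π s * (b : B)) = ε π s * (b : B)
    rw [← mul_assoc, hπ.ε_mul_self]
  · intro h
    exact ⟨a, Subtype.ext h⟩

theorem conj_mem_ideal (hπ : IsPartialRep π) (s : S) (a : subalg K π) :
    (⟨π s * (a : B) * π s⁻¹, hπ.conj_mem s a.2⟩ : subalg K π) ∈ ideal K π s := by
  rw [hπ.mem_ideal]
  change ε π s * (π s * (a : B) * π s⁻¹) = π s * (a : B) * π s⁻¹
  rw [mul_assoc (π s), ← mul_assoc (ε π s), hπ.ε_mul_π]

theorem conj_conj (hπ : IsPartialRep π) (s : S) (a : subalg K π) (ha : a ∈ ideal K π s) :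
    π s * (π s⁻¹ * (a : B) * π s) * π s⁻¹ = a := by
  have h := (hπ.mem_ideal s a).1 ha
  calc π s * (π s⁻¹ * (a : B) * π s) * π s⁻¹ = ε π s * (a : B) * ε π s := by
        simp only [ε, mul_assoc]
    _ = a := by rw [h, ← hπ.ε_comm_mem s a.2, h]

variable (K) in
/-- The map `α_s : X_{s⁻¹} → X_s`, `a ↦ π(s) a π(s⁻¹)`. -/
def conjEquiv (hπ : IsPartialRep π) (s : S) : ideal K π s⁻¹ ≃ₗ[K] ideal K π s where
  toFun a := ⟨⟨π s * ((a : subalg K π) : B) * π s⁻¹, hπ.conj_mem s (a : subalg K π).2⟩,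
    hπ.conj_mem_ideal s (a : subalg K π)⟩
  map_add' a b := by
    ext
    change π s * (((a : subalg K π) : B) + ((b : subalg K π) : B)) * π s⁻¹ = 
      π s * ((a : subalg K π) : B) * π s⁻¹ + π s * ((b : subalg K π) : B) * π s⁻¹
    rw [mul_add, add_mul]
  map_smul' c a := by
    ext
    change π s * (c • ((a : subalg K π) : B)) * π s⁻¹ = 
      c • (π s * ((a : subalg K π) : B) * π s⁻¹)
    rw [mul_smul_comm, smul_mul_assoc]
  invFun a := ⟨⟨π s⁻¹ * ((a : subalg K π) : B) * π s, by
      have h := hπ.conj_mem s⁻¹ (a : subalg K π).2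
      rwa [inv_inv'] at h⟩, by
      have h := hπ.conj_mem_ideal s⁻¹ (a : subalg K π)
      simp only [inv_inv'] at h
      exact h⟩
  left_inv a := by
    ext
    have h := hπ.conj_conj s⁻¹ a.1 a.2
    rw [inv_inv'] at h
    exact h
  right_inv a := by
    ext
    exact hπ.conj_conj s a.1 a.2

variable (K) in
/-- The partial action `α^π` of `S` on `A` induced by a partial representation `π` of `S` in `B`:
`X_s = ε_s A` and `α_s(a) = π(s) a π(s⁻¹)`. -/
def partialAction (hπ : IsPartialRep π) : PartialAction K S (subalg K π) where
  X := ideal K π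
  mul_mem_left s a x hx := by
    rw [hπ.mem_ideal] at hx ⊢
    change ε π s * ((a : B) * (x : B)) = (a : B) * (x : B)
    rw [← mul_assoc, hπ.ε_comm_mem s a.2, mul_assoc, hx]
  mul_mem_right s a x hx := by
    rw [hπ.mem_ideal] at hx ⊢
    change ε π s * ((x : B) * (a : B)) = (x : B) * (a : B)
    rw [← mul_assoc, hx]
  α := conjEquiv K hπ
  map_mul s x y := Subtype.ext (hπ.conj_mul s _ x.1.2)
  symm_eq s x := by
    ext
    change π s⁻¹⁻¹ * ((x : subalg K π) : B) * π s⁻¹ = π s * ((x : subalg K π) : B) * π s⁻¹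
    rw [inv_inv']
  mem_iff s t x := by
    rw [hπ.mem_ideal, hπ.mem_ideal]
    have hx := (hπ.mem_ideal _ _).1 x.2
    have hc := hπ.conj_conj s⁻¹ x.1 x.2
    change _ ↔ ε π (s * t) * (π s * ((x : subalg K π) : B) * π s⁻¹)
      = π s * ((x : subalg K π) : B) * π s⁻¹
    have h1 : ε π (s * t) * (π s * ((x : subalg K π) : B) * π s⁻¹)
        = π s * (ε π t * ((x : subalg K π) : B)) * π s⁻¹ := by
      rw [← mul_assoc, ← mul_assoc, ← hπ.π_mul_ε]; simp only [mul_assoc]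
    rw [h1]
    constructor
    · intro h; rw [h]
    · intro h
      have hm : (⟨ε π t, ε_mem K π t⟩ : subalg K π) * x ∈ ideal K π s⁻¹ := by
        rw [hπ.mem_ideal]
        change ε π s⁻¹ * (ε π t * ((x : subalg K π) : B)) = ε π t * ((x : subalg K π) : B)
        rw [← mul_assoc, hπ.ε_comm, mul_assoc, hx]
      have hc' := hπ.conj_conj s⁻¹ _ hm
      rw [inv_inv'] at hc hc'
      change π s⁻¹ * (π s * (ε π t * ((x : subalg K π) : B)) * π s⁻¹) * π s
        = ε π t * ((x : subalg K π) : B) at hc'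
      rw [← hc', h, hc]
  comp_eq s t a h1 h2 h3 := by
    ext
    change π s * (π t * (a : B) * π t⁻¹) * π s⁻¹ = π (s * t) * (a : B) * π (s * t)⁻¹
    have h := (hπ.mem_ideal _ _).1 h1
    have h' : (a : B) * ε π t⁻¹ = a := by rw [← hπ.ε_comm_mem t⁻¹ a.2, h]
    have e1 : π s * π t * ε π t⁻¹ = π (s * t) * ε π t⁻¹ := by
      rw [ε, inv_inv', ← mul_assoc, ← mul_assoc, hπ.mul_mul_inv]
    have e2 : ε π t⁻¹ * (π t⁻¹ * π s⁻¹) = ε π t⁻¹ * π (t⁻¹ * s⁻¹) := by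
      rw [ε, inv_inv', mul_assoc, mul_assoc, ← mul_assoc (π t), hπ.mul_mul_inv']
    calc π s * (π t * (a : B) * π t⁻¹) * π s⁻¹
        = π s * π t * (ε π t⁻¹ * (a * ε π t⁻¹)) * (π t⁻¹ * π s⁻¹) := by
          rw [h', h]; simp only [mul_assoc]
      _ = (π s * π t * ε π t⁻¹) * a * (ε π t⁻¹ * (π t⁻¹ * π s⁻¹)) := by simp only [mul_assoc]
      _ = π (s * t) * (ε π t⁻¹ * (a * ε π t⁻¹)) * π (t⁻¹ * s⁻¹) := by
          rw [e1, e2]; simp only [mul_assoc]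
      _ = π (s * t) * (a : B) * π (s * t)⁻¹ := by rw [h', h, mul_inv_rev']

variable (K) in
/-- The linear map `L → B`, `∑ a_s δ_s ↦ ∑ a_s π(s)`. -/
noncomputable def sumMap (hπ : IsPartialRep π) : (partialAction K hπ).L →ₗ[K] B :=
  (partialAction K hπ).liftL fun s =>
    (LinearMap.mulRight K (π s)).comp
      ((subalg K π).toSubmodule.subtype.comp ((partialAction K hπ).X s).subtype)

theorem sumMap_δ (hπ : IsPartialRep π) (s : S) (a : (partialAction K hπ).X s) :
    sumMap K hπ ((partialAction K hπ).δ s a) = ((a : subalg K π) : B) * π s :=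
  (partialAction K hπ).liftL_δ _ s a

end IsPartialRep

/-! ### The quotient `B / J` -/

section Quotient

variable {S B : Type*} [InverseMonoid S] [Ring B]

/-- The two-sided ideal `J` of `B` generated by all `a π(s) - a π(t)` with `a ∈ B` and `s ≤ t`. -/
def idealJ (π : S → B) : TwoSidedIdeal B :=
  TwoSidedIdeal.span {x | ∃ (a : B) (s t : S), NatLE s t ∧ x = a * π s - a * π t}

/-- The quotient algebra `B / J`. -/
abbrev QuotJ (π : S → B) : Type _ := (idealJ π).ringCon.Quotient

/-- The map `π̃ : S → B / J`, the composition of `π` with the quotient map. -/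
def tildeRep (π : S → B) (s : S) : QuotJ π := (idealJ π).ringCon.mk' (π s)

theorem IsPartialRep.tilde {π : S → B} (hπ : IsPartialRep π) : IsPartialRep (tildeRep π) :=
  hπ.map ((idealJ π).ringCon.mk' : B →ₙ* QuotJ π)

end Quotient

/-! ### The semigroup `Pr(S)` and the partial semigroup algebra -/

/-- The defining relations of `Pr(S)`. -/
inductive PrRel (S : Type*) [InverseMonoid S] : FreeSemigroup S → FreeSemigroup S → Prop
  | inv_mul_mul (s t : S) : PrRel S
      (FreeSemigroup.of s⁻¹ * FreeSemigroup.of s * FreeSemigroup.of t)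
      (FreeSemigroup.of s⁻¹ * FreeSemigroup.of (s * t))
  | mul_mul_inv (s t : S) : PrRel S
      (FreeSemigroup.of s * FreeSemigroup.of t * FreeSemigroup.of t⁻¹)
      (FreeSemigroup.of (s * t) * FreeSemigroup.of t⁻¹)
  | mul_inv_mul (s : S) : PrRel S
      (FreeSemigroup.of s * FreeSemigroup.of s⁻¹ * FreeSemigroup.of s)
      (FreeSemigroup.of s)

/-- `Pr(S)`: the semigroup generated by symbols `[s]`, `s ∈ S`, subject to the relations above. -/
def PrSemigroup (S : Type*) [InverseMonoid S] : Type _ := (conGen (PrRel S)).Quotient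

namespace PrSemigroup

variable {S : Type*} [InverseMonoid S]

instance : Semigroup (PrSemigroup S) := inferInstanceAs (Semigroup (conGen (PrRel S)).Quotient)

/-- The generator `[s]`. -/
def of (s : S) : PrSemigroup S := ((FreeSemigroup.of s : FreeSemigroup S) : (conGen (PrRel S)).Quotient)

theorem of_isPartialRep : IsPartialRep (of : S → PrSemigroup S) where
  inv_mul_mul s t := (Con.eq _).2 (ConGen.Rel.of _ _ (PrRel.inv_mul_mul s t))
  mul_mul_inv s t := (Con.eq _).2 (ConGen.Rel.of _ _ (PrRel.mul_mul_inv s t))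
  mul_inv_mul s := (Con.eq _).2 (ConGen.Rel.of _ _ (PrRel.mul_inv_mul s))

theorem induction_of {p : PrSemigroup S → Prop} (x : PrSemigroup S) (h1 : ∀ s, p (of s))
    (h2 : ∀ s y, p y → p (of s * y)) : p x := by
  induction x using Con.induction_on with
  | H w =>
    induction w using FreeSemigroup.recOnMul with
    | ih1 s => exact h1 s
    | ih2 s y _ hy => exact h2 s _ hy

/-- The relations make `[1]` the unit of `Pr(S)`. -/
instance : Monoid (PrSemigroup S) :=
  { (inferInstance : Semigroup (PrSemigroup S)) with
    one := of 1
    one_mul := fun x => by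
      change of 1 * x = x
      refine induction_of (p := fun x => of 1 * x = x) x of_isPartialRep.one_mul' fun s y _ => ?_
      rw [← mul_assoc, of_isPartialRep.one_mul']
    mul_one := fun x => by
      change x * of 1 = x
      refine induction_of (p := fun x => x * of 1 = x) x of_isPartialRep.mul_one' fun s y h => ?_
      rw [mul_assoc, h] }

end PrSemigroup

/-- The partial semigroup algebra `K_par(S)`, the semigroup algebra of `Pr(S)` over `K`. -/
abbrev KPar (K S : Type*) [CommRing K] [InverseMonoid S] : Type _ :=
  MonoidAlgebra K (PrSemigroup S)

/-- The canonical map `ι_S : S → K_par(S)`, `s ↦ [s]`. -/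
noncomputable def iotaPar (K S : Type*) [CommRing K] [InverseMonoid S] (s : S) : KPar K S :=
  MonoidAlgebra.of K (PrSemigroup S) (PrSemigroup.of s)

theorem iotaPar_isPartialRep (K S : Type*) [CommRing K] [InverseMonoid S] :
    IsPartialRep (iotaPar K S) :=
  PrSemigroup.of_isPartialRep.map
    (MonoidAlgebra.of K (PrSemigroup S) : PrSemigroup S →ₙ* KPar K S)

/-! Write `π` for the map `s ↦ [s]` into `B = K_par(S)/J`, and `ε s = π s * π s⁻¹`. Then `π` is a
partial representation, the `ε s` commute with each other and hence with all of `A`, and comparable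
elements of `S` have the same image.

Inside `B` the product rule of `L` reads `(a δ_s)(b δ_t) = (a π(s) b π(s⁻¹)) δ_{st}`. Since `b`
commutes with `ε s⁻¹`, which `π s` absorbs, `a π(s) b π(s⁻¹) π(st) = a π(s) b π(t)`. So `∑ a_s δ_s ↦
∑ a_s π(s)` is multiplicative (`sumMap_mul`). It kills `I` because `π` identifies comparable
elements, and this gives `φ`. The image contains `φ(ε_s δ_s) = π(s)`, and these generate `B`, so `φ`
is onto.

For injectivity, the classes of `ε_s δ_s` form a partial representation of `S` in the crossed
product that also identifies comparable elements (`εδ_isPartialRep`, `εδ_congr`). Left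
multiplication by them is therefore a unital partial representation in endomorphisms, and the
universal property of `K_par(S)/J` yields `Ψ : B → End_K(A ×_α S)`. The relation `ss⁻¹ ≤ 1` gives
`(ε_s δ_s)(ε_{s⁻¹} δ_{s⁻¹}) = ε_s δ_1`, so `Ψ(a)` is multiplication by `a δ_1` for every `a` in `A`.
Hence `Ψ(φ(y))` is left multiplication by `y` (`apply_sumMap`). Evaluating at the unit `ε_1 δ_1`
recovers `y` from `φ(y)`. -/

namespace PartialAction

variable {K S A : Type*} [CommRing K] [InverseMonoid S] [NonUnitalRing A]
  [Module K A] [IsScalarTower K A A] [SMulCommClass K A A] (P : PartialAction K S A)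

theorem δ_congr {s t : S} (h : s = t) {a : P.X s} {b : P.X t} (hab : (a : A) = b) :
    P.δ s a = P.δ t b := by
  subst h
  rw [Subtype.ext hab]

theorem L_induction {p : P.L → Prop} (x : P.L) (zero : p 0)
    (δ : ∀ s a, p (P.δ s a)) (add : ∀ x y, p x → p y → p (x + y)) : p x := by
  classical
  exact DirectSum.induction_on x zero δ add

namespace CrossedProduct

theorem mk_δ_eq {r t : S} (h : NatLE r t) {a : P.X r} {b : P.X t} (hab : (a : A) = b) :
    mk P (P.δ r a) = mk P (P.δ t b) := by
  obtain rfl : b = ⟨(a : A), P.X_mono h a.2⟩ := Subtype.ext hab.symm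
  refine (mk_eq_mk P).2 ?_
  simp only [I, Submodule.mem_sInf]
  exact fun N hN => hN.1 ⟨r, t, h, a, rfl⟩

end CrossedProduct

end PartialAction

/-! ### Multiplication in `B` and associativity of the crossed product -/

namespace IsPartialRep

variable {K S B : Type*} [CommRing K] [InverseMonoid S] [Ring B] [Algebra K B] {π : S → B}

theorem ε_mul_X (hπ : IsPartialRep π) (s : S) (a : (partialAction K hπ).X s) :
    ε π s * ((a : subalg K π) : B) = ((a : subalg K π) : B) :=
  (hπ.mem_ideal s _).1 a.2

theorem X_mul_ε (hπ : IsPartialRep π) (s : S) (a : (partialAction K hπ).X s) :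
    ((a : subalg K π) : B) * ε π s = ((a : subalg K π) : B) := by
  rw [← hπ.ε_comm_mem s a.1.2, hπ.ε_mul_X]

/-- Expanding `α_s(α_{s⁻¹}(a) b)` leaves a factor `ε s` in front of `a`, which `a ∈ X_s` absorbs.
All later computations with `δ`'s rest on this formula. -/
theorem coe_mulAux (hπ : IsPartialRep π) (s t : S) (a : (partialAction K hπ).X s)
    (b : (partialAction K hπ).X t) :
    (((partialAction K hπ).mulAux s t a b : subalg K π) : B) =
      ((a : subalg K π) : B) * π s * ((b : subalg K π) : B) * π s⁻¹ := by
  change π s * ((π s⁻¹ * ((a : subalg K π) : B) * π s) * ((b : subalg K π) : B)) * π s⁻¹ = _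
  have h := hπ.ε_mul_X s a
  have h' := hπ.X_mul_ε s a
  calc _ = (ε π s * ((a : subalg K π) : B)) * π s * ((b : subalg K π) : B) * π s⁻¹ := by
        simp only [ε, mul_assoc]
    _ = _ := by rw [h]

/-- For an arbitrary partial action `L` need not be associative. Here both bracketings reduce to `a
π(r) b π(s) c π(s⁻¹) π(r⁻¹)`, because the idempotents `ε r⁻¹` and `ε s⁻¹` commute with the
coefficients. -/
theorem mulAux_assoc (hπ : IsPartialRep π) (r s t : S) (a : (partialAction K hπ).X r)
    (b : (partialAction K hπ).X s) (c : (partialAction K hπ).X t) :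
    ((partialAction K hπ).mulAux (r * s) t ((partialAction K hπ).mulAux r s a b) c : subalg K π) =
      ((partialAction K hπ).mulAux r (s * t) a ((partialAction K hπ).mulAux s t b c) :
        subalg K π) := by
  apply Subtype.ext
  simp only [coe_mulAux]
  have hb := hπ.ε_comm_mem r⁻¹ b.1.2
  have hc := hπ.ε_comm_mem s⁻¹ c.1.2
  generalize ((a : subalg K π) : B) = a at *
  generalize ((b : subalg K π) : B) = b at *
  generalize ((c : subalg K π) : B) = c at *
  have e1 : π r⁻¹ * π (r * s) = ε π r⁻¹ * π s := by
    rw [← hπ.inv_mul_mul, ε, inv_inv']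
  have e2 : ε π s⁻¹ * π (s⁻¹ * r⁻¹) = π s⁻¹ * ε π s * π r⁻¹ := by
    calc ε π s⁻¹ * π (s⁻¹ * r⁻¹) = π s⁻¹ * (π s * π (s⁻¹ * r⁻¹)) := by
          rw [ε, inv_inv', mul_assoc]
      _ = π s⁻¹ * ε π s * π r⁻¹ := by rw [← hπ.mul_mul_inv', ← mul_assoc, ε]
  have e3 : π s⁻¹ * ε π s = π s⁻¹ := by simpa [inv_inv'] using hπ.π_mul_ε_inv s⁻¹
  calc a * π r * b * π r⁻¹ * π (r * s) * c * π (r * s)⁻¹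
      = a * π r * b * (π r⁻¹ * π (r * s)) * c * π (r * s)⁻¹ := by simp only [mul_assoc]
    _ = a * π r * (b * ε π r⁻¹) * π s * c * π (r * s)⁻¹ := by rw [e1]; simp only [mul_assoc]
    _ = a * (π r * ε π r⁻¹) * b * π s * c * π (r * s)⁻¹ := by rw [← hb]; simp only [mul_assoc]
    _ = a * π r * b * (π s * ε π s⁻¹) * c * π (r * s)⁻¹ := by
        rw [hπ.π_mul_ε_inv, hπ.π_mul_ε_inv]
    _ = a * π r * b * π s * (ε π s⁻¹ * c) * π (s⁻¹ * r⁻¹) := by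
        rw [mul_inv_rev']; simp only [mul_assoc]
    _ = a * π r * b * π s * c * (ε π s⁻¹ * π (s⁻¹ * r⁻¹)) := by rw [hc]; simp only [mul_assoc]
    _ = _ := by rw [e2, e3]; simp only [mul_assoc]

noncomputable instance (hπ : IsPartialRep π) : NonUnitalRing (partialAction K hπ).L :=
  { (inferInstance : NonUnitalNonAssocRing (partialAction K hπ).L) with
    mul_assoc := fun x y z => by
      induction x using PartialAction.L_induction with
      | zero => simp only [zero_mul]
      | add x x' hx hx' => simp only [add_mul, hx, hx']
      | δ r a =>
      induction y using PartialAction.L_induction with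
      | zero => simp only [zero_mul, mul_zero]
      | add x x' hx hx' => simp only [add_mul, mul_add, hx, hx']
      | δ s b =>
      induction z using PartialAction.L_induction with
      | zero => simp only [mul_zero]
      | add x x' hx hx' => simp only [mul_add, hx, hx']
      | δ t c =>
      simp only [PartialAction.δ_mul_δ]
      exact PartialAction.δ_congr _ (mul_assoc r s t) (hπ.mulAux_assoc r s t a b c) }

noncomputable instance (hπ : IsPartialRep π) : NonUnitalRing (partialAction K hπ).CrossedProduct :=
  { (inferInstance : NonUnitalNonAssocRing (partialAction K hπ).CrossedProduct) with
    mul_assoc := fun x y z => by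
      obtain ⟨x, rfl⟩ := PartialAction.CrossedProduct.mk_surjective _ x
      obtain ⟨y, rfl⟩ := PartialAction.CrossedProduct.mk_surjective _ y
      obtain ⟨z, rfl⟩ := PartialAction.CrossedProduct.mk_surjective _ z
      simp only [← PartialAction.CrossedProduct.mk_mul, mul_assoc] }

/-! ### The homomorphism `φ` -/

theorem sumMap_mul (hπ : IsPartialRep π) (x y : (partialAction K hπ).L) :
    sumMap K hπ (x * y) = sumMap K hπ x * sumMap K hπ y := by
  induction x using PartialAction.L_induction with
  | zero => simp only [zero_mul, map_zero]
  | add x x' hx hx' => simp only [add_mul, map_add, hx, hx']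
  | δ s a =>
  induction y using PartialAction.L_induction with
  | zero => simp only [mul_zero, map_zero]
  | add x x' hx hx' => simp only [mul_add, map_add, hx, hx']
  | δ t b =>
  simp only [PartialAction.δ_mul_δ, sumMap_δ, coe_mulAux]
  have hb := hπ.ε_comm_mem s⁻¹ b.1.2
  generalize ((a : subalg K π) : B) = a at *
  generalize ((b : subalg K π) : B) = b at *
  -- `π(s⁻¹) π(st) = ε_{s⁻¹} π(t)`; the idempotent moves left past `b` and is absorbed by `π s`.
  calc a * π s * b * π s⁻¹ * π (s * t) = a * π s * b * (π s⁻¹ * π (s * t)) := by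
        simp only [mul_assoc]
    _ = a * π s * (b * ε π s⁻¹) * π t := by
        rw [← hπ.inv_mul_mul, ε, inv_inv']; simp only [mul_assoc]
    _ = a * (π s * ε π s⁻¹) * b * π t := by rw [← hb]; simp only [mul_assoc]
    _ = _ := by rw [hπ.π_mul_ε_inv]; simp only [mul_assoc]

theorem I_le_ker_sumMap (hπ : IsPartialRep π) (hle : ∀ r t : S, NatLE r t → π r = π t) :
    (partialAction K hπ).I ≤ LinearMap.ker (sumMap K hπ) := by
  -- The kernel is one of the subspaces whose intersection is `I`: it contains the relators and, by
  -- `sumMap_mul`, is closed under multiplication by `L`.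
  refine sInf_le ⟨?_, fun x y hy => ?_⟩
  · rintro _ ⟨r, t, h, a, rfl⟩
    change sumMap K hπ _ = 0
    rw [map_sub, sumMap_δ, sumMap_δ, hle r t h, sub_self]
  · rw [LinearMap.mem_ker] at hy
    simp only [LinearMap.mem_ker, sumMap_mul, hy, mul_zero, zero_mul, and_self]

/-- The homomorphism `A ×_α S → B`, `∑ a_s δ_s ↦ ∑ a_s π(s)`, induced by a partial representation
that identifies comparable elements. -/
noncomputable def crossedProductHom (hπ : IsPartialRep π)
    (hle : ∀ r t : S, NatLE r t → π r = π t) :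
    (partialAction K hπ).CrossedProduct →ₙₐ[K] B :=
  let f : (partialAction K hπ).CrossedProduct →ₗ[K] B :=
    (partialAction K hπ).I.liftQ (sumMap K hπ) (hπ.I_le_ker_sumMap hle)
  { f with
    map_zero' := map_zero f
    map_mul' := fun x y => by
      obtain ⟨x, rfl⟩ := PartialAction.CrossedProduct.mk_surjective _ x
      obtain ⟨y, rfl⟩ := PartialAction.CrossedProduct.mk_surjective _ y
      exact hπ.sumMap_mul x y }

theorem crossedProductHom_mk (hπ : IsPartialRep π) (hle : ∀ r t : S, NatLE r t → π r = π t)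
    (x : (partialAction K hπ).L) :
    hπ.crossedProductHom hle (PartialAction.CrossedProduct.mk _ x) = sumMap K hπ x := rfl

/-! ### The partial representation `s ↦ ε_s δ_s` in the crossed product -/

variable (K) in
/-- The class of `ε_s δ_s` in the crossed product. -/
noncomputable def εδ (hπ : IsPartialRep π) (s : S) : (partialAction K hπ).CrossedProduct :=
  PartialAction.CrossedProduct.mk _ ((partialAction K hπ).δ s
    ⟨⟨ε π s, ε_mem K π s⟩, (hπ.mem_ideal s _).2 (hπ.ε_mul_self s)⟩)

theorem crossedProductHom_εδ (hπ : IsPartialRep π) (hle : ∀ r t : S, NatLE r t → π r = π t)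
    (s : S) : hπ.crossedProductHom hle (hπ.εδ K s) = π s := by
  rw [εδ, crossedProductHom_mk, sumMap_δ]
  exact hπ.ε_mul_π s

/-- Moving `ε s⁻¹` across `π s` turns it into `ε (s * s⁻¹)`, while `π s` also absorbs `ε s⁻¹`
outright. -/
theorem ε_mul_inv_mul_ε (hπ : IsPartialRep π) (s : S) : ε π (s * s⁻¹) * ε π s = ε π s := by
  calc ε π (s * s⁻¹) * ε π s = ε π (s * s⁻¹) * π s * π s⁻¹ := by rw [ε, ε, mul_assoc _ (π s)]
    _ = ε π s := by rw [← hπ.π_mul_ε, hπ.π_mul_ε_inv, ε]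

theorem ε_eq_of_natLE (hle : ∀ r t : S, NatLE r t → π r = π t) {r t : S} (h : NatLE r t) :
    ε π r = ε π t := by
  have h' : NatLE r⁻¹ t⁻¹ := by
    -- Inverting `r = (r r⁻¹) t` gives `r⁻¹ = t⁻¹ (r r⁻¹)`.
    refine ⟨r * r⁻¹, mul_inv_idem r, ?_⟩
    conv_lhs => rw [h.eq_left, mul_inv_rev', inv_of_idem (mul_inv_idem r)]
  rw [ε, ε, hle r t h, hle _ _ h']

theorem εδ_congr (hπ : IsPartialRep π) (hle : ∀ r t : S, NatLE r t → π r = π t) {r t : S}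
    (h : NatLE r t) : hπ.εδ K r = hπ.εδ K t := by
  refine PartialAction.CrossedProduct.mk_δ_eq _ h (Subtype.ext ?_)
  exact ε_eq_of_natLE hle h

/-- Splits an identity between classes into one equation in `S` for the index and one in `B` for the
coefficient, avoiding transport between the ideals `X (s * t)` and `X r`. -/
theorem mk_δ_mul_mk_δ (hπ : IsPartialRep π) {s t r : S} (a : (partialAction K hπ).X s)
    (b : (partialAction K hπ).X t) (c : (partialAction K hπ).X r) (hr : s * t = r)
    (h : ((a : subalg K π) : B) * π s * ((b : subalg K π) : B) * π s⁻¹ = (c : subalg K π)) :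
    PartialAction.CrossedProduct.mk _ ((partialAction K hπ).δ s a) *
      PartialAction.CrossedProduct.mk _ ((partialAction K hπ).δ t b) =
      PartialAction.CrossedProduct.mk _ ((partialAction K hπ).δ r c) := by
  rw [← PartialAction.CrossedProduct.mk_mul, PartialAction.δ_mul_δ]
  congr 1
  refine PartialAction.δ_congr _ hr (Subtype.ext ?_)
  rw [coe_mulAux, h]

theorem εδ_mul_εδ (hπ : IsPartialRep π) (s t : S) : hπ.εδ K s * hπ.εδ K t =
    PartialAction.CrossedProduct.mk _ ((partialAction K hπ).δ (s * t)
      ⟨⟨ε π s * ε π (s * t), mul_mem (ε_mem K π _) (ε_mem K π _)⟩, (hπ.mem_ideal _ _).2 (by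
        change ε π (s * t) * (ε π s * ε π (s * t)) = ε π s * ε π (s * t)
        rw [hπ.ε_comm s, ← mul_assoc, hπ.ε_mul_self])⟩) := by
  refine hπ.mk_δ_mul_mk_δ _ _ _ rfl ?_
  change ε π s * π s * ε π t * π s⁻¹ = ε π s * ε π (s * t)
  rw [hπ.ε_mul_π, hπ.π_mul_ε, mul_assoc, ← ε, hπ.ε_comm]

theorem εδ_isPartialRep (hπ : IsPartialRep π) (hle : ∀ r t : S, NatLE r t → π r = π t) : IsPartialRep (hπ.εδ K) where
  inv_mul_mul s t := by
    rw [εδ_mul_εδ, εδ_mul_εδ]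
    refine hπ.mk_δ_mul_mk_δ _ _ _ (by rw [mul_assoc]) ?_
    change ε π s⁻¹ * ε π (s⁻¹ * s) * π (s⁻¹ * s) * ε π t * π (s⁻¹ * s)⁻¹ =
      ε π s⁻¹ * ε π (s⁻¹ * (s * t))
    have h := hπ.ε_mul_inv_mul_ε s⁻¹
    rw [inv_inv'] at h
    rw [hπ.ε_comm, h, mul_assoc (ε π s⁻¹), hπ.π_mul_ε, mul_assoc, mul_assoc, ← ε,
      hπ.ε_comm (s⁻¹ * s * t), ← mul_assoc, hπ.ε_comm, h, mul_assoc s⁻¹]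
  mul_mul_inv s t := by
    rw [εδ_mul_εδ, εδ_mul_εδ]
    refine hπ.mk_δ_mul_mk_δ _ _ _ rfl ?_
    change ε π s * ε π (s * t) * π (s * t) * ε π t⁻¹ * π (s * t)⁻¹ =
      ε π (s * t) * ε π (s * t * t⁻¹)
    -- Here `s t t⁻¹ = s (t t⁻¹) ≤ s`. Of the three axioms, this is the only one whose proof needs
    -- comparable elements to be identified.
    have h : ε π (s * t * t⁻¹) = ε π s :=
      ε_eq_of_natLE hle ⟨t * t⁻¹, mul_inv_idem t, mul_assoc _ _ _⟩
    rw [mul_assoc (ε π s), hπ.ε_mul_π, mul_assoc (ε π s), hπ.π_mul_ε, mul_assoc, mul_assoc, ← ε,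
      h, ← mul_assoc, hπ.ε_mul_self, hπ.ε_comm]
  mul_inv_mul s := by
    rw [εδ_mul_εδ]
    refine hπ.mk_δ_mul_mk_δ _ _ _ (mul_inv_mul' s) ?_
    change ε π s * ε π (s * s⁻¹) * π (s * s⁻¹) * ε π s * π (s * s⁻¹)⁻¹ = ε π s
    rw [hπ.ε_comm, hπ.ε_mul_inv_mul_ε, mul_assoc (ε π s), hπ.π_mul_ε, mul_assoc, mul_assoc, ← ε,
      mul_inv_mul', hπ.ε_comm s (s * s⁻¹), hπ.ε_mul_inv_mul_ε, hπ.ε_mul_self]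

/-! ### Coefficients `a δ_1`, the unit, and injectivity -/

theorem ε_one (h1 : π 1 = 1) : ε π 1 = 1 := by
  have : (1 : S)⁻¹ = 1 := inv_of_idem (mul_one 1)
  rw [ε, this, h1, mul_one]

theorem mem_ideal_one (hπ : IsPartialRep π) (h1 : π 1 = 1) (a : subalg K π) :
    a ∈ (partialAction K hπ).X 1 :=
  (hπ.mem_ideal 1 a).2 (by rw [ε_one h1, one_mul])

/-- `a ↦ a δ_1`, as a map from the base algebra to the crossed product. -/
noncomputable def coeffHom (hπ : IsPartialRep π) (h1 : π 1 = 1) :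
    subalg K π →ₙₐ[K] (partialAction K hπ).CrossedProduct where
  toFun a := PartialAction.CrossedProduct.mk _ ((partialAction K hπ).δ 1
    ⟨a, hπ.mem_ideal_one h1 a⟩)
  map_smul' c a := by
    simp only [← map_smul]
    rfl
  map_zero' := by
    simp only [← map_zero (PartialAction.CrossedProduct.mk _),
      ← map_zero ((partialAction K hπ).δ 1)]
    rfl
  map_add' a b := by
    simp only [← map_add]
    rfl
  map_mul' a b := by
    refine (hπ.mk_δ_mul_mk_δ _ _ _ (mul_one 1) ?_).symm
    rw [inv_of_idem (mul_one 1), h1, mul_one, mul_one]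
    rfl

/-- The product on the right is `ε_s δ_{ss⁻¹}`, and `ss⁻¹ ≤ 1` lets the ideal `I` replace the index
by `1`. -/
theorem coeffHom_ε (hπ : IsPartialRep π) (h1 : π 1 = 1) (s : S) :
    hπ.coeffHom h1 ⟨ε π s, ε_mem K π s⟩ = hπ.εδ K s * hπ.εδ K s⁻¹ := by
  rw [εδ_mul_εδ]
  refine (PartialAction.CrossedProduct.mk_δ_eq _
    ⟨s * s⁻¹, mul_inv_idem s, (one_mul _).symm⟩ (Subtype.ext ?_)).symm
  change ε π s * ε π (s * s⁻¹) = ε π s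
  rw [hπ.ε_comm, hπ.ε_mul_inv_mul_ε]

theorem coeffHom_mul_εδ (hπ : IsPartialRep π) (h1 : π 1 = 1) (s : S)
    (a : (partialAction K hπ).X s) :
    hπ.coeffHom h1 (a : subalg K π) * hπ.εδ K s =
      PartialAction.CrossedProduct.mk _ ((partialAction K hπ).δ s a) := by
  refine hπ.mk_δ_mul_mk_δ _ _ _ (one_mul s) ?_
  rw [inv_of_idem (mul_one 1), h1, mul_one, mul_one]
  exact hπ.X_mul_ε s a

theorem εδ_one_mul (hπ : IsPartialRep π) (h1 : π 1 = 1)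
    (x : (partialAction K hπ).CrossedProduct) : hπ.εδ K 1 * x = x := by
  obtain ⟨x, rfl⟩ := PartialAction.CrossedProduct.mk_surjective _ x
  induction x using PartialAction.L_induction with
  | zero => rw [map_zero, mul_zero]
  | add x y hx hy => rw [map_add, mul_add, hx, hy]
  | δ s a =>
    refine hπ.mk_δ_mul_mk_δ _ _ _ (one_mul s) ?_
    rw [inv_of_idem (mul_one 1), h1, mul_one, mul_one]
    change ε π 1 * _ = _
    rw [ε_one h1, one_mul]

theorem mul_εδ_one (hπ : IsPartialRep π) (h1 : π 1 = 1)
    (x : (partialAction K hπ).CrossedProduct) : x * hπ.εδ K 1 = x := by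
  obtain ⟨x, rfl⟩ := PartialAction.CrossedProduct.mk_surjective _ x
  induction x using PartialAction.L_induction with
  | zero => rw [map_zero, zero_mul]
  | add x y hx hy => rw [map_add, add_mul, hx, hy]
  | δ s a =>
    refine hπ.mk_δ_mul_mk_δ _ _ _ (mul_one s) ?_
    change _ * ε π 1 * _ = _
    rw [ε_one h1, mul_one, mul_assoc]
    exact hπ.X_mul_ε s a

/-- Both sides are linear and multiplicative in `a`, so it suffices to compare them on the
generators `ε t`, where `coeffHom_ε` applies. -/
theorem apply_eq_coeffHom_mul (hπ : IsPartialRep π) (h1 : π 1 = 1)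
    (Ψ : B →ₐ[K] Module.End K (partialAction K hπ).CrossedProduct)
    (hΨ : ∀ s x, Ψ (π s) x = hπ.εδ K s * x) {a : B} (ha : a ∈ subalg K π)
    (x : (partialAction K hπ).CrossedProduct) : Ψ a x = hπ.coeffHom h1 ⟨a, ha⟩ * x := by
  induction ha using NonUnitalAlgebra.adjoin_induction generalizing x with
  | mem y hy =>
    obtain ⟨t, rfl⟩ := hy
    have h : Ψ (ε π t) = Ψ (π t) * Ψ (π t⁻¹) := map_mul Ψ _ _
    have h' := hπ.coeffHom_ε (K := K) h1 t
    rw [h, Module.End.mul_apply, hΨ, hΨ, ← mul_assoc, ← h']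
  | add y z hy' hz' hy hz =>
    have h : hπ.coeffHom h1 ⟨y + z, add_mem hy' hz'⟩ =
      hπ.coeffHom h1 ⟨y, hy'⟩ + hπ.coeffHom h1 ⟨z, hz'⟩ := map_add (hπ.coeffHom h1) ⟨y, hy'⟩ ⟨z, hz'⟩
    rw [map_add, LinearMap.add_apply, hy, hz, ← add_mul, ← h]
  | zero =>
    rw [map_zero, LinearMap.zero_apply]
    exact (zero_mul x).symm.trans (congrArg (· * x) (map_zero (hπ.coeffHom h1)).symm)
  | mul y z hy' hz' hy hz =>
    have h : hπ.coeffHom h1 ⟨y * z, mul_mem hy' hz'⟩ =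
      hπ.coeffHom h1 ⟨y, hy'⟩ * hπ.coeffHom h1 ⟨z, hz'⟩ := map_mul (hπ.coeffHom h1) ⟨y, hy'⟩ ⟨z, hz'⟩
    rw [map_mul, Module.End.mul_apply, hz, hy, ← mul_assoc, ← h]
  | smul r y hy' hy =>
    have h : hπ.coeffHom h1 ⟨r • y, SMulMemClass.smul_mem r hy'⟩ =
      r • hπ.coeffHom h1 ⟨y, hy'⟩ := map_smul (hπ.coeffHom h1) r ⟨y, hy'⟩
    rw [map_smul, LinearMap.smul_apply, hy, ← smul_mul_assoc, ← h]

/-- On `a δ_s` the operator `Ψ(a π(s))` is left multiplication by `(a δ_1)(ε_s δ_s) = a δ_s`. Thus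
`Ψ ∘ φ` is the left regular representation. -/
theorem apply_sumMap (hπ : IsPartialRep π) (h1 : π 1 = 1)
    (Ψ : B →ₐ[K] Module.End K (partialAction K hπ).CrossedProduct)
    (hΨ : ∀ s x, Ψ (π s) x = hπ.εδ K s * x) (y : (partialAction K hπ).L)
    (x : (partialAction K hπ).CrossedProduct) :
    Ψ (sumMap K hπ y) x = PartialAction.CrossedProduct.mk _ y * x := by
  induction y using PartialAction.L_induction with
  | zero => simp only [map_zero, LinearMap.zero_apply, zero_mul]
  | add y z hy hz => simp only [map_add, LinearMap.add_apply, add_mul, hy, hz]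
  | δ s a =>
    rw [sumMap_δ, map_mul, Module.End.mul_apply, hΨ,
      hπ.apply_eq_coeffHom_mul h1 Ψ hΨ (a : subalg K π).2, ← mul_assoc]
    exact congrArg (· * x) (hπ.coeffHom_mul_εδ h1 s a)

/-- `crossedProductHom` is injective as soon as left multiplication by the elements `ε_s δ_s`
extends to a representation of `B`. -/
theorem crossedProductHom_injective (hπ : IsPartialRep π) (h1 : π 1 = 1)
    (hle : ∀ r t : S, NatLE r t → π r = π t)
    (Ψ : B →ₐ[K] Module.End K (partialAction K hπ).CrossedProduct)
    (hΨ : ∀ s x, Ψ (π s) x = hπ.εδ K s * x) :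
    Function.Injective (hπ.crossedProductHom (K := K) hle) := by
  intro x y hxy
  obtain ⟨x, rfl⟩ := PartialAction.CrossedProduct.mk_surjective _ x
  obtain ⟨y, rfl⟩ := PartialAction.CrossedProduct.mk_surjective _ y
  rw [crossedProductHom_mk, crossedProductHom_mk] at hxy
  -- Each class is the value at `ε_1 δ_1` of left multiplication by it, hence is determined by its
  -- image under `φ`.
  rw [← hπ.mul_εδ_one h1 (PartialAction.CrossedProduct.mk _ x),
    ← hπ.mul_εδ_one h1 (PartialAction.CrossedProduct.mk _ y),
    ← hπ.apply_sumMap h1 Ψ hΨ, ← hπ.apply_sumMap h1 Ψ hΨ, hxy]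

end IsPartialRep

/-! ### Universal property and generators of `K_par(S)/J` -/

theorem tildeRep_eq {S B : Type*} [InverseMonoid S] [Ring B] (π : S → B) (r t : S)
    (h : NatLE r t) : tildeRep π r = tildeRep π t := by
  refine (RingCon.eq _).2 ((TwoSidedIdeal.rel_iff _ _ _).2 (TwoSidedIdeal.subset_span ?_))
  exact ⟨1, r, t, h, by rw [one_mul, one_mul]⟩

/-- The universal property of `Pr(S)`, for partial representations in monoids that preserve the
unit. -/
def PrSemigroup.lift {S M : Type*} [InverseMonoid S] [Monoid M] {π : S → M}
    (hπ : IsPartialRep π) (h1 : π 1 = 1) : PrSemigroup S →* M where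
  toFun x := Con.liftOn x (FreeSemigroup.lift π) fun a b h => by
    have hle : conGen (PrRel S) ≤ Con.ker (FreeSemigroup.lift π) := by
      refine Con.conGen_le.2 ?_
      rintro _ _ (⟨s, t⟩ | ⟨s, t⟩ | s)
      · exact hπ.inv_mul_mul s t
      · exact hπ.mul_mul_inv s t
      · exact hπ.mul_inv_mul s
    exact hle h
  map_one' := h1
  map_mul' x y := by
    induction x using Con.induction_on
    induction y using Con.induction_on
    exact map_mul (FreeSemigroup.lift π) _ _

theorem PrSemigroup.lift_of {S M : Type*} [InverseMonoid S] [Monoid M] {π : S → M}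
    (hπ : IsPartialRep π) (h1 : π 1 = 1) (s : S) : PrSemigroup.lift hπ h1 (of s) = π s := rfl

/-- The homomorphism from `K_par(S) / J` induced by a unital partial representation that
identifies comparable elements. -/
theorem exists_quotJ_lift {K S M : Type*} [CommRing K] [InverseMonoid S] [Ring M] [Algebra K M]
    {π : S → M} (hπ : IsPartialRep π) (h1 : π 1 = 1) (hle : ∀ r t : S, NatLE r t → π r = π t) :
    ∃ f : QuotJ (iotaPar K S) →ₐ[K] M, ∀ s, f (tildeRep (iotaPar K S) s) = π s := by
  let F : KPar K S →ₐ[K] M := MonoidAlgebra.lift K M (PrSemigroup S) (PrSemigroup.lift hπ h1)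
  have hF : ∀ s, F (iotaPar K S s) = π s := fun s => by
    simp only [F, iotaPar, MonoidAlgebra.lift_of, PrSemigroup.lift_of]
  have hJ : idealJ (iotaPar K S) ≤ TwoSidedIdeal.ker F.toRingHom := by
    refine TwoSidedIdeal.span_le.2 ?_
    rintro _ ⟨a, s, t, h, rfl⟩
    refine (TwoSidedIdeal.mem_ker _).2 ?_
    change F _ = 0
    rw [map_sub, map_mul, map_mul, hF, hF, hle s t h, sub_self]
  refine ⟨RingCon.liftₐ _ F fun x y h => ?_, hF⟩
  have h := (TwoSidedIdeal.mem_ker _).1 (hJ ((TwoSidedIdeal.rel_iff _ _ _).1 h))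
  rwa [map_sub, sub_eq_zero] at h

/-- A subalgebra of `K_par(S) / J` that contains all the classes of the `[s]` is everything. -/
theorem quotJ_induction {K S : Type*} [CommRing K] [InverseMonoid S]
    (N : NonUnitalSubalgebra K (QuotJ (iotaPar K S))) (h : ∀ s, tildeRep (iotaPar K S) s ∈ N)
    (x : QuotJ (iotaPar K S)) : x ∈ N := by
  obtain ⟨x, rfl⟩ := (idealJ (iotaPar K S)).ringCon.mk'_surjective x
  -- Every element of `Pr(S)` is a nonempty product of symbols `[s]`, and the unit is `[1]`, so
  -- closure under sums, products and scalars is enough.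
  induction x using MonoidAlgebra.induction_on with
  | of m =>
    induction m using PrSemigroup.induction_of with
    | h1 s => exact h s
    | h2 s y hy =>
      rw [map_mul, map_mul]
      exact mul_mem (h s) hy
  | add x y hx hy => rw [map_add]; exact add_mem hx hy
  | smul r x hx => exact SMulMemClass.smul_mem r hx


theorem theorem2p7 (K S : Type*) [CommRing K] [InverseMonoid S] :
    ∃ φ : ((iotaPar_isPartialRep K S).tilde.partialAction K).CrossedProduct →ₙₐ[K]
        QuotJ (iotaPar K S),
      (∀ x : ((iotaPar_isPartialRep K S).tilde.partialAction K).L,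
        φ (PartialAction.CrossedProduct.mk _ x) =
          (iotaPar_isPartialRep K S).tilde.sumMap K x) ∧
      Function.Bijective φ := by
  have hπ := (iotaPar_isPartialRep K S).tilde
  have hle := tildeRep_eq (iotaPar K S)
  have h1 : tildeRep (iotaPar K S) 1 = 1 := rfl
  -- Passing to left multiplications lands in a unital `K`-algebra, as the universal property
  -- requires; `ε_1 δ_1` becomes the identity operator.
  have hD := (hπ.εδ_isPartialRep (K := K) hle).map
    
    ({ toFun := LinearMap.mulLeft K, map_mul' := LinearMap.mulLeft_mul K _ } :
      (hπ.partialAction K).CrossedProduct →ₙ* Module.End K (hπ.partialAction K).CrossedProduct)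
  obtain ⟨Ψ, hΨ⟩ := exists_quotJ_lift (K := K) hD
    (LinearMap.ext fun x => hπ.εδ_one_mul h1 x)
    fun r t h => congrArg _ (hπ.εδ_congr hle h)
  refine ⟨hπ.crossedProductHom hle, hπ.crossedProductHom_mk hle,
    hπ.crossedProductHom_injective h1 hle Ψ
      fun s x => LinearMap.congr_fun (hΨ s) x, fun b => ?_⟩
  exact (NonUnitalAlgHom.mem_range _).1
    (quotJ_induction (NonUnitalAlgHom.range (hπ.crossedProductHom (K := K) hle))
      (fun s => (NonUnitalAlgHom.mem_range _).2 ⟨_, hπ.crossedProductHom_εδ hle s⟩) b)
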